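/- Let $n\in\mathbb{N}$ and let $M_n(\mathbb{C})$ denote the complex $n\times n$ matrices. The logarithm of a positive definite matrix is defined by the functional calculus. For $A\in M_n(\mathbb{C})$ positive definite and $B\in M_n(\mathbb{C})$, set $$T_A(B)=\int_0^\infty (s+A)^{-1}\,B\,(s+A)^{-1}\,ds .$$ (a) For every self-adjoint $H\in M_n(\mathbb{C})$, the function $X\mapsto \operatorname{tr}\left[e^{H+\log X}\right]$ is real-valued and concave on the set of positive definite matrices in $M_n(\mathbb{C})$. (b) The integral defining $T_A(B)$ converges absolutely for all positive definite $A$ and all $B$ in $M_n(\mathbb{C})$, and if $B$ is self-adjoint, then $$T_A(B)=\frac{d}{dt}\log(A+tB)\Big|_{t=0}.$$ (c) For all self-adjoint $H,K,L\in M_n(\mathbb{C})$, both sides of the following inequality are real, and $$\operatorname{tr}\left[e^{H+K+L}\right]\le \operatorname{tr}\left[e^{H}\,T_{e^{-K}}(e^{L})\right].$$ -/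

import Mathlib

open Matrix MeasureTheory Set
open scoped ComplexOrder Matrix.Norms.L2Operator

/-- The integrand `s ↦ (s + A)⁻¹ B (s + A)⁻¹`, where `s` stands for `s` times the identity. -/
noncomputable def resolventSandwich {n : ℕ} (A B : Matrix (Fin n) (Fin n) ℂ) (s : ℝ) :
    Matrix (Fin n) (Fin n) ℂ :=
  ((s : ℂ) • (1 : Matrix (Fin n) (Fin n) ℂ) + A)⁻¹ * B *
    ((s : ℂ) • (1 : Matrix (Fin n) (Fin n) ℂ) + A)⁻¹

/-- `T_A(B) = ∫₀^∞ (s + A)⁻¹ B (s + A)⁻¹ ds`, a Bochner integral in the space of matrices. -/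
noncomputable def liebT {n : ℕ} (A B : Matrix (Fin n) (Fin n) ℂ) : Matrix (Fin n) (Fin n) ℂ :=
  ∫ s in Ioi (0 : ℝ), resolventSandwich A B s

/-! Concavity reduces to joint convexity of the relative entropy D(A,B) = tr B(log B - log A) - tr B
+ tr A. The scalar identity b(log b - log a) - b + a = ∫₀^∞ (a-b)²/(a+sb) (1+s)⁻² ds lifts to D(A,B)
= ∫₀^∞ ⟨A-B, (L_A + sR_B)⁻¹(A-B)⟩ (1+s)⁻² ds, with L_A, R_B left and right multiplication.
Completing the square makes each integrand a supremum of functions affine in (A,B), hence jointly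
convex. By Gibbs, tr exp(H + log X) = max_T [tr TH - D(X,T) + tr X], and maximizing a jointly
concave function over T leaves a concave function of X.

The derivative of log comes from log C - log A = ∫ (s+A)⁻¹(C-A)(s+C)⁻¹ ds and the resolvent
identity.

For the triple inequality, F(X) = tr exp(H + log X) is concave and homogeneous of degree one, so
F(Y) ≤ (F(X+tY) - F(X))/t for t > 0. Convexity of tr exp bounds the right side, and t → 0⁺ yields
tr[exp(H + log X) T_X(Y)]. -/

/-! ### Spectral resolutions -/

/-- A resolution of a matrix into orthogonal projections with real coefficients. -/
structure SpectralResolution {n : ℕ} (A : Matrix (Fin n) (Fin n) ℂ) where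
  /-- the eigenvalues -/
  val : Fin n → ℝ
  /-- the projections -/
  proj : Fin n → Matrix (Fin n) (Fin n) ℂ
  proj_mul_proj : ∀ i j, proj i * proj j = if i = j then proj i else 0
  conjTranspose_proj : ∀ i, (proj i)ᴴ = proj i
  sum_proj : ∑ i, proj i = 1
  cfc_eq : ∀ f : ℝ → ℝ, cfc f A = ∑ i, f (val i) • proj i
  sum_val : ∑ i, val i • proj i = A
  val_pos : A.PosDef → ∀ i, 0 < val i

/-- The projections are the rank-one U Eᵢᵢ U*; repeated eigenvalues stay separate, so no
distinctness is needed. -/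
theorem Matrix.IsHermitian.nonempty_spectralResolution {n : ℕ} {A : Matrix (Fin n) (Fin n) ℂ}
    (hA : A.IsHermitian) : Nonempty (SpectralResolution A) := by
  set U : Matrix (Fin n) (Fin n) ℂ := (hA.eigenvectorUnitary : Matrix (Fin n) (Fin n) ℂ) with hU
  have hUU : star U * U = 1 := Unitary.coe_star_mul_self hA.eigenvectorUnitary
  have hUU' : U * star U = 1 := Unitary.coe_mul_star_self hA.eigenvectorUnitary
  have hdiag : ∀ d : Fin n → ℝ, U * diagonal (fun i => (d i : ℂ)) * star U =
      ∑ i, d i • (U * single i i 1 * star U) := by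
    intro d
    have : diagonal (fun i => (d i : ℂ)) = ∑ i, d i • (single i i (1 : ℂ)) := by
      ext k l
      simp only [Matrix.sum_apply, Matrix.smul_apply, Matrix.single_apply, diagonal_apply]
      by_cases hkl : k = l
      · subst hkl; simp
      · simp only [hkl, if_false]
        refine (Finset.sum_eq_zero fun i _ => ?_).symm
        rw [if_neg (by rintro ⟨rfl, rfl⟩; exact hkl rfl), smul_zero]
    rw [this, Finset.mul_sum, Finset.sum_mul]
    simp only [mul_smul_comm, smul_mul_assoc]
  have hcfc : ∀ f : ℝ → ℝ, cfc f A = ∑ i, f (hA.eigenvalues i) • (U * single i i 1 * star U) := by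
    intro f
    rw [← hdiag, hA.cfc_eq]
    rfl
  refine ⟨⟨hA.eigenvalues, fun i => U * single i i 1 * star U, ?_, ?_, ?_, hcfc, ?_,
    fun h => h.eigenvalues_pos⟩⟩
  · intro i j
    have : U * single i i 1 * star U * (U * single j j 1 * star U) =
        U * (single i i 1 * single j j 1) * star U := by
      calc _ = U * single i i 1 * (star U * U) * single j j 1 * star U := by noncomm_ring
        _ = _ := by rw [hUU]; noncomm_ring
    rw [this]
    split_ifs with h
    · subst h; simp
    · simp [single_mul_single_of_ne, h]
  · intro i
    simp [Matrix.star_eq_conjTranspose, Matrix.conjTranspose_mul, mul_assoc]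
  · have := hdiag 1
    simp only [Pi.one_apply, one_smul, Complex.ofReal_one, diagonal_one, mul_one] at this
    rw [← this, hUU']
  · have := hcfc id
    exact this.symm.trans (cfc_id ℝ A hA)

namespace SpectralResolution

variable {n : ℕ} {A : Matrix (Fin n) (Fin n) ℂ}

theorem sum_smul_mul_sum_smul (P : SpectralResolution A) (f g : Fin n → ℝ) :
    (∑ i, f i • P.proj i) * (∑ i, g i • P.proj i) = ∑ i, (f i * g i) • P.proj i := by
  simp only [Finset.sum_mul, Finset.mul_sum, smul_mul_assoc, mul_smul_comm, P.proj_mul_proj]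
  refine Finset.sum_congr rfl fun i _ => ?_
  simp [smul_smul, mul_comm]

theorem exp_eq (P : SpectralResolution A) (hA : A.IsHermitian) :
    NormedSpace.exp A = ∑ i, Real.exp (P.val i) • P.proj i := by
  rw [← P.cfc_eq, CFC.real_exp_eq_normedSpace_exp hA]

theorem log_eq (P : SpectralResolution A) :
    CFC.log A = ∑ i, Real.log (P.val i) • P.proj i := P.cfc_eq _

theorem resolvent_eq (P : SpectralResolution A) (hA : A.PosDef) {s : ℝ} (hs : 0 ≤ s) :
    ((s : ℂ) • (1 : Matrix (Fin n) (Fin n) ℂ) + A)⁻¹ = ∑ i, (s + P.val i)⁻¹ • P.proj i := by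
  have h : (s : ℂ) • (1 : Matrix (Fin n) (Fin n) ℂ) + A = ∑ i, (s + P.val i) • P.proj i := by
    simp only [add_smul, Finset.sum_add_distrib, P.sum_val, ← Finset.smul_sum, P.sum_proj]
    simp
  apply Matrix.inv_eq_right_inv
  rw [h, P.sum_smul_mul_sum_smul, ← P.sum_proj]
  refine Finset.sum_congr rfl fun i _ => ?_
  have := P.val_pos hA i
  rw [mul_inv_cancel₀ (by positivity), one_smul]

end SpectralResolution

theorem Matrix.IsHermitian.cfcLog {n : ℕ} (A : Matrix (Fin n) (Fin n) ℂ) :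
    (CFC.log A).IsHermitian := IsSelfAdjoint.log

theorem Matrix.IsHermitian.posDef_exp {n : ℕ} {A : Matrix (Fin n) (Fin n) ℂ}
    (hA : A.IsHermitian) : (NormedSpace.exp A).PosDef := by
  have hS : IsSelfAdjoint A := hA
  open scoped MatrixOrder in
  have h1 : 0 ≤ NormedSpace.exp A := hS.exp_nonneg
  rw [← isStrictlyPositive_iff_posDef]
  exact (Matrix.isUnit_exp A).isStrictlyPositive h1

/-! ### Scalar integrals -/

open Filter Topology in
theorem tendsto_log_add_mul_sub_log {a b c d : ℝ} (hb : 0 < b) (hd : 0 < d) :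
    Tendsto (fun s : ℝ => Real.log (a + s * b) - Real.log (c + s * d)) atTop
      (𝓝 (Real.log b - Real.log d)) := by
  have key : ∀ a b : ℝ, 0 < b →
      Tendsto (fun s : ℝ => Real.log (a + s * b) - Real.log s) atTop (𝓝 (Real.log b)) := by
    intro a b hb
    have h1 : Tendsto (fun s : ℝ => a * s⁻¹ + b) atTop (𝓝 (a * 0 + b)) :=
      (tendsto_inv_atTop_zero.const_mul a).add_const b
    rw [mul_zero, zero_add] at h1
    refine (h1.log hb.ne').congr' ?_
    filter_upwards [eventually_gt_atTop 0, h1.eventually (lt_mem_nhds hb)] with s hs hs'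
    rw [← Real.log_div _ hs.ne']
    · congr 1; field_simp
    · have : a + s * b = s * (a * s⁻¹ + b) := by field_simp
      rw [this]; positivity
  simpa using (key a b hb).sub (key c d hd)

/-- Partial fractions: the kernel is b²/(a+sb) - b/(1+s) + (a-b)/(1+s)². Writing `1 + s * 1` matches
`tendsto_log_add_mul_sub_log`. -/
theorem hasDerivAt_relEntropy_primitive {a b : ℝ} (ha : 0 < a) (hb : 0 < b) {s : ℝ} (hs : 0 ≤ s) :
    HasDerivAt (fun s : ℝ => b * (Real.log (a + s * b) - Real.log (1 + s * 1)) - (a - b) / (1 + s))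
      ((a - b) ^ 2 / (a + s * b) * ((1 + s) ^ 2)⁻¹) s := by
  have h1 : HasDerivAt (fun s : ℝ => a + s * b) b s := by
    simpa using ((hasDerivAt_id s).mul_const b).const_add a
  have h2 : HasDerivAt (fun s : ℝ => 1 + s * 1) 1 s := by
    simpa using ((hasDerivAt_id s).const_add 1)
  have h3 : HasDerivAt (fun s : ℝ => 1 + s) 1 s := by
    simpa using ((hasDerivAt_id s).const_add 1)
  have p1 : 0 < a + s * b := by positivity
  have p2 : 0 < 1 + s := by positivity
  refine ((((h1.log p1.ne').sub (h2.log (by positivity))).const_mul b).sub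
    ((hasDerivAt_const s (a - b)).div h3 p2.ne')).congr_deriv ?_
  field_simp
  ring

open Filter Topology in
theorem tendsto_relEntropy_primitive {a b : ℝ} (hb : 0 < b) :
    Tendsto (fun s : ℝ => b * (Real.log (a + s * b) - Real.log (1 + s * 1)) - (a - b) / (1 + s))
      atTop (𝓝 (b * Real.log b)) := by
  have h1 := (tendsto_log_add_mul_sub_log (a := a) (c := 1) hb one_pos).const_mul b
  have h2 : Tendsto (fun s : ℝ => (a - b) / (1 + s)) atTop (𝓝 0) :=
    tendsto_const_nhds.div_atTop (tendsto_atTop_add_const_left _ _ tendsto_id)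
  simpa using h1.sub h2

theorem integrableOn_relEntropy_kernel {a b : ℝ} (ha : 0 < a) (hb : 0 < b) :
    IntegrableOn (fun s : ℝ => (a - b) ^ 2 / (a + s * b) * ((1 + s) ^ 2)⁻¹) (Ioi 0) :=
  integrableOn_Ioi_deriv_of_nonneg' (fun _ hs => hasDerivAt_relEntropy_primitive ha hb hs)
    (fun s hs => by have : (0 : ℝ) < s := hs; positivity) (tendsto_relEntropy_primitive hb)

theorem integral_relEntropy_kernel {a b : ℝ} (ha : 0 < a) (hb : 0 < b) :
    ∫ s in Ioi (0 : ℝ), (a - b) ^ 2 / (a + s * b) * ((1 + s) ^ 2)⁻¹ =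
      b * (Real.log b - Real.log a) - b + a := by
  rw [integral_Ioi_of_hasDerivAt_of_nonneg'
    (fun _ hs => hasDerivAt_relEntropy_primitive ha hb hs)
    (fun s hs => by have : (0 : ℝ) < s := hs; positivity) (tendsto_relEntropy_primitive hb)]
  simp
  ring

theorem integrableOn_inv_add_mul_inv_add {a b : ℝ} (ha : 0 < a) (hb : 0 < b) :
    IntegrableOn (fun s : ℝ => (s + a)⁻¹ * (s + b)⁻¹) (Ioi 0) := by
  have key : ∀ c : ℝ, 0 < c → IntegrableOn (fun s : ℝ => (s + c) ^ (-2 : ℝ)) (Ioi 0) :=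
    fun c hc => integrableOn_add_rpow_Ioi_of_lt (by norm_num) (by linarith)
  refine Integrable.mono' ((key a ha).add (key b hb)) (by fun_prop) ?_
  refine (ae_restrict_mem measurableSet_Ioi).mono fun s hs => ?_
  have hs : 0 < s := hs
  have e : ∀ c : ℝ, 0 < c → (s + c) ^ (-2 : ℝ) = (s + c)⁻¹ ^ 2 := fun c hc => by
    rw [Real.rpow_neg (by positivity), inv_pow]; norm_num
  simp only [Pi.add_apply, e a ha, e b hb]
  rw [Real.norm_of_nonneg (by positivity)]
  nlinarith [sq_nonneg ((s + a)⁻¹ - (s + b)⁻¹), sq_nonneg ((s + a)⁻¹), sq_nonneg ((s + b)⁻¹)]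

/-- Keeping the factor b - a on the left covers a = b. -/
theorem integral_inv_add_mul_inv_add {a b : ℝ} (ha : 0 < a) (hb : 0 < b) :
    (∫ s in Ioi (0 : ℝ), (s + a)⁻¹ * (s + b)⁻¹) * (b - a) = Real.log b - Real.log a := by
  rw [← integral_mul_const]
  have hd : ∀ s ∈ Ici (0 : ℝ), HasDerivAt
      (fun s => Real.log (a + s * 1) - Real.log (b + s * 1)) ((s + a)⁻¹ * (s + b)⁻¹ * (b - a)) s := by
    intro s hs
    have hs : 0 ≤ s := hs
    have h : ∀ c : ℝ, HasDerivAt (fun s : ℝ => c + s * 1) 1 s := fun c => by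
      simpa using ((hasDerivAt_id s).const_add c)
    have p1 : 0 < a + s * 1 := by positivity
    have p2 : 0 < b + s * 1 := by positivity
    refine (((h a).log p1.ne').sub ((h b).log p2.ne')).congr_deriv ?_
    have p1 : 0 < s + a := by positivity
    have p2 : 0 < s + b := by positivity
    rw [mul_one, add_comm a, add_comm b]
    field_simp
    ring
  rw [integral_Ioi_of_hasDerivAt_of_tendsto' hd
    ((integrableOn_inv_add_mul_inv_add ha hb).mul_const _)
    (tendsto_log_add_mul_sub_log one_pos one_pos)]
  simp

/-! ### The Hilbert-Schmidt form -/

section TraceForm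

variable {n : ℕ}

theorem re_trace_conjTranspose_mul_self_nonneg (M : Matrix (Fin n) (Fin n) ℂ) :
    0 ≤ (trace (Mᴴ * M)).re :=
  (Complex.nonneg_iff.mp (Matrix.posSemidef_conjTranspose_mul_self M).trace_nonneg).1

theorem re_trace_conjTranspose_mul_comm (M N : Matrix (Fin n) (Fin n) ℂ) :
    (trace (Mᴴ * N)).re = (trace (Nᴴ * M)).re := by
  rw [← Complex.conj_re, ← Complex.star_def, ← trace_conjTranspose, conjTranspose_mul,
    conjTranspose_conjTranspose]

/-- Expand ‖eM - dN‖² ≥ 0 and divide by e. -/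
theorem two_mul_trace_sub_le {d e : ℝ} (he : 0 < e) (M N : Matrix (Fin n) (Fin n) ℂ) :
    2 * d * (trace (Mᴴ * N)).re - e * (trace (Mᴴ * M)).re ≤ d ^ 2 / e * (trace (Nᴴ * N)).re := by
  have h := re_trace_conjTranspose_mul_self_nonneg (e • M - d • N)
  have h2 : (trace ((e • M - d • N)ᴴ * (e • M - d • N))).re =
      e * (e * (trace (Mᴴ * M)).re - 2 * d * (trace (Mᴴ * N)).re) + d ^ 2 * (trace (Nᴴ * N)).re := by
    simp only [conjTranspose_sub, conjTranspose_smul, star_trivial, sub_mul, mul_sub,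
      smul_mul_assoc, mul_smul_comm, trace_sub, trace_smul, Complex.sub_re, Complex.real_smul,
      Complex.re_ofReal_mul, re_trace_conjTranspose_mul_comm N M]
    ring
  rw [h2] at h
  have : d ^ 2 / e * (trace (Nᴴ * N)).re = (d ^ 2 * (trace (Nᴴ * N)).re) / e := by ring
  rw [this, le_div_iff₀ he]
  linarith

end TraceForm

namespace SpectralResolution

variable {n : ℕ} {A B : Matrix (Fin n) (Fin n) ℂ}

/-- The squared Hilbert-Schmidt norm of the product of two spectral projections. -/
noncomputable def overlap (P : SpectralResolution A) (Q : SpectralResolution B) (i j : Fin n) : ℝ :=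
  (trace (P.proj i * Q.proj j)).re

theorem trace_conjTranspose_sandwich_mul (P : SpectralResolution A) (Q : SpectralResolution B)
    (Y Z : Matrix (Fin n) (Fin n) ℂ) (i j : Fin n) :
    trace ((P.proj i * Y * Q.proj j)ᴴ * (P.proj i * Z * Q.proj j)) =
      trace (Yᴴ * P.proj i * Z * Q.proj j) := by
  have hP := P.proj_mul_proj i i
  have hQ := Q.proj_mul_proj j j
  rw [if_pos rfl] at hP hQ
  simp only [conjTranspose_mul, P.conjTranspose_proj, Q.conjTranspose_proj]
  calc _ = trace (Q.proj j * (Yᴴ * (P.proj i * P.proj i) * Z * Q.proj j)) := by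
        simp only [mul_assoc]
    _ = trace (Yᴴ * P.proj i * Z * (Q.proj j * Q.proj j)) := by
        rw [trace_mul_comm, hP]; simp only [mul_assoc]
    _ = _ := by rw [hQ]

theorem overlap_eq (P : SpectralResolution A) (Q : SpectralResolution B) (i j : Fin n) :
    P.overlap Q i j = (trace ((P.proj i * Q.proj j)ᴴ * (P.proj i * Q.proj j))).re := by
  have := P.trace_conjTranspose_sandwich_mul Q 1 1 i j
  simp only [mul_one, conjTranspose_one, one_mul] at this
  rw [this, overlap]

theorem overlap_nonneg (P : SpectralResolution A) (Q : SpectralResolution B) (i j : Fin n) :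
    0 ≤ P.overlap Q i j := by
  rw [overlap_eq]
  exact re_trace_conjTranspose_mul_self_nonneg _

theorem sum_smul_left (P : SpectralResolution A) (Q : SpectralResolution B) (f : Fin n → ℝ) :
    ∑ i, f i • P.proj i = ∑ i, ∑ j, f i • (P.proj i * Q.proj j) := by
  simp only [← Finset.smul_sum, ← Finset.mul_sum, Q.sum_proj, mul_one]

theorem sum_smul_right (P : SpectralResolution A) (Q : SpectralResolution B) (f : Fin n → ℝ) :
    ∑ j, f j • Q.proj j = ∑ i, ∑ j, f j • (P.proj i * Q.proj j) := by
  rw [Finset.sum_comm]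
  simp only [← Finset.smul_sum, ← Finset.sum_mul, P.sum_proj, one_mul]

end SpectralResolution

/-! ### Integral representation of the relative entropy -/

/-- The Umegaki relative entropy of `B` with respect to `A`, for unnormalised states. -/
noncomputable def matrixRelEntropy {n : ℕ} (A B : Matrix (Fin n) (Fin n) ℂ) : ℝ :=
  (trace (B * (CFC.log B - CFC.log A))).re - (trace B).re + (trace A).re

/-- A function affine in `(A, B)` whose supremum over `Z` is the quadratic form
`⟨A - B, (L_A + s R_B)⁻¹ (A - B)⟩`. -/
noncomputable def relEntropyMinorant {n : ℕ} (Z : Matrix (Fin n) (Fin n) ℂ) (s : ℝ)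
    (A B : Matrix (Fin n) (Fin n) ℂ) : ℝ :=
  2 * (trace (Zᴴ * (A - B))).re - (trace (Zᴴ * A * Z)).re - s * (trace (Zᴴ * Z * B)).re

namespace SpectralResolution

variable {n : ℕ} {A B : Matrix (Fin n) (Fin n) ℂ}

/-- A and B need not commute, but every term of D is a trace of PᵢQⱼ combinations, so D is a sum of
scalar entropies with overlap weights. -/
theorem matrixRelEntropy_eq (P : SpectralResolution A) (Q : SpectralResolution B) :
    matrixRelEntropy A B = ∑ i, ∑ j, (Q.val j * (Real.log (Q.val j) - Real.log (P.val i)) -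
      Q.val j + P.val i) * P.overlap Q i j := by
  have h1 : B * CFC.log B = ∑ i, ∑ j, (Q.val j * Real.log (Q.val j)) • (P.proj i * Q.proj j) := by
    rw [← P.sum_smul_right Q, ← Q.sum_smul_mul_sum_smul, Q.sum_val, Q.log_eq]
  have h2 : trace (B * CFC.log A) =
      trace (∑ i, ∑ j, (Q.val j * Real.log (P.val i)) • (P.proj i * Q.proj j)) := by
    rw [trace_mul_comm, P.log_eq]
    conv_lhs => rw [← Q.sum_val]
    rw [Finset.sum_comm]
    simp only [Finset.sum_mul, Finset.mul_sum, smul_mul_assoc, mul_smul_comm, smul_smul,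
      Finset.smul_sum]
  have h3 := Q.sum_val.symm.trans (P.sum_smul_right Q _)
  have h4 := P.sum_val.symm.trans (P.sum_smul_left Q _)
  rw [matrixRelEntropy, mul_sub, trace_sub, h1, h2]
  conv_lhs =>
    enter [2, 1]
    rw [h4]
  conv_lhs =>
    enter [1, 2, 1]
    rw [h3]
  simp only [trace_sum, trace_smul, Complex.sub_re, Complex.re_sum, Complex.real_smul,
    Complex.re_ofReal_mul, ← Finset.sum_sub_distrib, ← Finset.sum_add_distrib, overlap]
  refine Finset.sum_congr rfl fun i _ => Finset.sum_congr rfl fun j _ => ?_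
  ring

/-- The blocks PᵢZQⱼ decouple, so the supremum over Z can be taken block by block. -/
theorem relEntropyMinorant_eq (P : SpectralResolution A) (Q : SpectralResolution B)
    (Z : Matrix (Fin n) (Fin n) ℂ) (s : ℝ) :
    relEntropyMinorant Z s A B = ∑ i, ∑ j,
      (2 * (P.val i - Q.val j) *
          (trace ((P.proj i * Z * Q.proj j)ᴴ * (P.proj i * Q.proj j))).re -
        (P.val i + s * Q.val j) *
          (trace ((P.proj i * Z * Q.proj j)ᴴ * (P.proj i * Z * Q.proj j))).re) := by
  have h0 : A - B = ∑ i, ∑ j, (P.val i - Q.val j) • (P.proj i * Q.proj j) := by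
    simp only [sub_smul, Finset.sum_sub_distrib, ← P.sum_smul_left Q, ← P.sum_smul_right Q,
      P.sum_val, Q.sum_val]
  have h1 : Zᴴ * A * Z = ∑ i, ∑ j, P.val i • (Zᴴ * P.proj i * Z * Q.proj j) := by
    simp only [← Finset.smul_sum, ← Finset.mul_sum, Q.sum_proj, mul_one]
    conv_lhs => rw [← P.sum_val]
    simp only [Finset.sum_mul, Finset.mul_sum, smul_mul_assoc, mul_smul_comm]
  have h2 : Zᴴ * Z * B = ∑ i, ∑ j, Q.val j • (Zᴴ * P.proj i * Z * Q.proj j) := by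
    rw [Finset.sum_comm]
    simp only [← Finset.smul_sum, ← Finset.sum_mul, ← Finset.mul_sum, P.sum_proj, mul_one]
    conv_lhs => rw [← Q.sum_val]
    simp only [Finset.mul_sum, mul_smul_comm]
  have h3 : ∀ i j, trace ((P.proj i * Z * Q.proj j)ᴴ * (P.proj i * Q.proj j)) =
      trace (Zᴴ * (P.proj i * Q.proj j)) := by
    intro i j
    have := P.trace_conjTranspose_sandwich_mul Q Z 1 i j
    simpa only [mul_one, mul_assoc] using this
  rw [relEntropyMinorant, h0, h1, h2]
  simp only [h3, trace_conjTranspose_sandwich_mul, Finset.mul_sum, mul_smul_comm, trace_sum,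
    trace_smul, Complex.re_sum, Complex.real_smul, Complex.re_ofReal_mul,
    ← Finset.sum_sub_distrib]
  refine Finset.sum_congr rfl fun i _ => Finset.sum_congr rfl fun j _ => ?_
  ring

/-- The quadratic form `⟨A - B, (L_A + s R_B)⁻¹ (A - B)⟩`. -/
noncomputable def entropyForm (P : SpectralResolution A) (Q : SpectralResolution B) (s : ℝ) : ℝ :=
  ∑ i, ∑ j, (P.val i - Q.val j) ^ 2 / (P.val i + s * Q.val j) * P.overlap Q i j

theorem relEntropyMinorant_le (P : SpectralResolution A) (Q : SpectralResolution B)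
    (hA : A.PosDef) (hB : B.PosDef) {s : ℝ} (hs : 0 ≤ s) (Z : Matrix (Fin n) (Fin n) ℂ) :
    relEntropyMinorant Z s A B ≤ P.entropyForm Q s := by
  rw [P.relEntropyMinorant_eq Q, entropyForm]
  refine Finset.sum_le_sum fun i _ => Finset.sum_le_sum fun j _ => ?_
  rw [overlap_eq]
  have := P.val_pos hA i
  have := Q.val_pos hB j
  exact two_mul_trace_sub_le (by positivity) _ _

theorem exists_relEntropyMinorant_eq (P : SpectralResolution A) (Q : SpectralResolution B)
    (hA : A.PosDef) (hB : B.PosDef) {s : ℝ} (hs : 0 ≤ s) :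
    ∃ Z, relEntropyMinorant Z s A B = P.entropyForm Q s := by
  -- Block coefficients of the maximizer Z = (L_A + sR_B)⁻¹(A - B).
  set c : Fin n → Fin n → ℝ := fun i j => (P.val i - Q.val j) / (P.val i + s * Q.val j) with hc
  refine ⟨∑ k, ∑ l, c k l • (P.proj k * Q.proj l), ?_⟩
  have hZ : ∀ i j, P.proj i * (∑ k, ∑ l, c k l • (P.proj k * Q.proj l)) * Q.proj j =
      c i j • (P.proj i * Q.proj j) := by
    intro i j
    have : ∀ k l, P.proj i * (P.proj k * Q.proj l) * Q.proj j =
        if i = k then (if l = j then P.proj i * Q.proj j else 0) else 0 := by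
      intro k l
      rw [← mul_assoc, P.proj_mul_proj, mul_assoc, Q.proj_mul_proj]
      split_ifs with h1 h2 <;> simp [*]
    simp only [Finset.mul_sum, Finset.sum_mul, mul_smul_comm, smul_mul_assoc, this]
    simp
  rw [P.relEntropyMinorant_eq Q, entropyForm]
  refine Finset.sum_congr rfl fun i _ => Finset.sum_congr rfl fun j _ => ?_
  simp only [hZ, conjTranspose_smul, star_trivial, smul_mul_assoc, mul_smul_comm, trace_smul,
    Complex.real_smul, Complex.re_ofReal_mul, ← overlap_eq]
  have := P.val_pos hA i
  have := Q.val_pos hB j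
  have : 0 < P.val i + s * Q.val j := by positivity
  simp only [hc]
  field_simp
  ring

theorem integrableOn_entropyForm (P : SpectralResolution A) (Q : SpectralResolution B)
    (hA : A.PosDef) (hB : B.PosDef) :
    IntegrableOn (fun s : ℝ => P.entropyForm Q s * ((1 + s) ^ 2)⁻¹) (Ioi 0) := by
  simp only [entropyForm, Finset.sum_mul]
  refine integrable_finsetSum _ fun i _ => integrable_finsetSum _ fun j _ => ?_
  simp only [mul_right_comm _ (P.overlap Q i j)]
  exact (integrableOn_relEntropy_kernel (P.val_pos hA i) (Q.val_pos hB j)).mul_const _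

theorem integral_entropyForm (P : SpectralResolution A) (Q : SpectralResolution B)
    (hA : A.PosDef) (hB : B.PosDef) :
    ∫ s in Ioi (0 : ℝ), P.entropyForm Q s * ((1 + s) ^ 2)⁻¹ = matrixRelEntropy A B := by
  have hint : ∀ i j, IntegrableOn (fun s : ℝ => (P.val i - Q.val j) ^ 2 /
      (P.val i + s * Q.val j) * ((1 + s) ^ 2)⁻¹ * P.overlap Q i j) (Ioi 0) := fun i j =>
    (integrableOn_relEntropy_kernel (P.val_pos hA i) (Q.val_pos hB j)).mul_const _
  simp only [entropyForm, Finset.sum_mul, mul_right_comm _ (P.overlap Q _ _)]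
  rw [integral_finsetSum _ fun i _ => integrable_finsetSum _ fun j _ => hint i j,
    P.matrixRelEntropy_eq Q]
  refine Finset.sum_congr rfl fun i _ => ?_
  rw [integral_finsetSum _ fun j _ => hint i j]
  refine Finset.sum_congr rfl fun j _ => ?_
  rw [integral_mul_const, integral_relEntropy_kernel (P.val_pos hA i) (Q.val_pos hB j)]

end SpectralResolution

/-! ### Positivity and joint convexity of the relative entropy -/

section Entropy

variable {n : ℕ}

theorem matrixRelEntropy_nonneg {A B : Matrix (Fin n) (Fin n) ℂ} (hA : A.PosDef) (hB : B.PosDef) :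
    0 ≤ matrixRelEntropy A B := by
  obtain ⟨P⟩ := hA.1.nonempty_spectralResolution
  obtain ⟨Q⟩ := hB.1.nonempty_spectralResolution
  rw [← P.integral_entropyForm Q hA hB]
  refine setIntegral_nonneg measurableSet_Ioi fun s hs => ?_
  have hs : 0 < s := hs
  refine mul_nonneg (Finset.sum_nonneg fun i _ => Finset.sum_nonneg fun j _ => ?_) (by positivity)
  have := P.val_pos hA i
  have := Q.val_pos hB j
  exact mul_nonneg (by positivity) (P.overlap_nonneg Q i j)

theorem relEntropyMinorant_combo (Z : Matrix (Fin n) (Fin n) ℂ) (s : ℝ)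
    (A₁ A₂ B₁ B₂ : Matrix (Fin n) (Fin n) ℂ) (α β : ℝ) :
    relEntropyMinorant Z s (α • A₁ + β • A₂) (α • B₁ + β • B₂) =
      α * relEntropyMinorant Z s A₁ B₁ + β * relEntropyMinorant Z s A₂ B₂ := by
  simp only [relEntropyMinorant, mul_add, add_mul, mul_sub, mul_smul_comm, smul_mul_assoc,
    trace_add, trace_sub, trace_smul, Complex.add_re, Complex.sub_re, Complex.real_smul,
    Complex.re_ofReal_mul]
  ring

theorem Matrix.PosDef.combo {A₁ A₂ : Matrix (Fin n) (Fin n) ℂ} (h₁ : A₁.PosDef) (h₂ : A₂.PosDef)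
    {α β : ℝ} (hα : 0 ≤ α) (hβ : 0 ≤ β) (h : α + β = 1) : (α • A₁ + β • A₂).PosDef := by
  rcases hα.eq_or_lt with rfl | hα
  · obtain rfl : β = 1 := by linarith
    simpa using h₂
  · exact (h₁.smul hα).add_posSemidef (h₂.posSemidef.smul hβ)

theorem matrixRelEntropy_combo_le {A₁ A₂ B₁ B₂ : Matrix (Fin n) (Fin n) ℂ}
    (hA₁ : A₁.PosDef) (hA₂ : A₂.PosDef) (hB₁ : B₁.PosDef) (hB₂ : B₂.PosDef)
    {α β : ℝ} (hα : 0 ≤ α) (hβ : 0 ≤ β) (h : α + β = 1) :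
    matrixRelEntropy (α • A₁ + β • A₂) (α • B₁ + β • B₂) ≤
      α * matrixRelEntropy A₁ B₁ + β * matrixRelEntropy A₂ B₂ := by
  have hA := hA₁.combo hA₂ hα hβ h
  have hB := hB₁.combo hB₂ hα hβ h
  obtain ⟨P⟩ := hA.1.nonempty_spectralResolution
  obtain ⟨Q⟩ := hB.1.nonempty_spectralResolution
  obtain ⟨P₁⟩ := hA₁.1.nonempty_spectralResolution
  obtain ⟨Q₁⟩ := hB₁.1.nonempty_spectralResolution
  obtain ⟨P₂⟩ := hA₂.1.nonempty_spectralResolution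
  obtain ⟨Q₂⟩ := hB₂.1.nonempty_spectralResolution
  have i₁ := P₁.integrableOn_entropyForm Q₁ hA₁ hB₁
  have i₂ := P₂.integrableOn_entropyForm Q₂ hA₂ hB₂
  rw [← P.integral_entropyForm Q hA hB, ← P₁.integral_entropyForm Q₁ hA₁ hB₁,
    ← P₂.integral_entropyForm Q₂ hA₂ hB₂, ← integral_const_mul, ← integral_const_mul,
    ← integral_add (i₁.const_mul α) (i₂.const_mul β)]
  refine setIntegral_mono_on (P.integrableOn_entropyForm Q hA hB)
    ((i₁.const_mul α).add (i₂.const_mul β)) measurableSet_Ioi fun s hs => ?_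
  have hs : 0 < s := hs
  -- The Z optimal at the convex combination is a competitor at both endpoints.
  obtain ⟨Z, hZ⟩ := P.exists_relEntropyMinorant_eq Q hA hB hs.le
  rw [← hZ, relEntropyMinorant_combo, ← mul_assoc, ← mul_assoc, ← add_mul]
  have := P₁.relEntropyMinorant_le Q₁ hA₁ hB₁ hs.le Z
  have := P₂.relEntropyMinorant_le Q₂ hA₂ hB₂ hs.le Z
  gcongr

end Entropy

/-! ### Resolvents and the derivative of the logarithm -/

section Resolvent

variable {n : ℕ}

/-- The resolvent `(s + A)⁻¹`. -/
noncomputable def posResolvent (A : Matrix (Fin n) (Fin n) ℂ) (s : ℝ) : Matrix (Fin n) (Fin n) ℂ :=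
  ((s : ℂ) • (1 : Matrix (Fin n) (Fin n) ℂ) + A)⁻¹

theorem resolventSandwich_eq (A B : Matrix (Fin n) (Fin n) ℂ) (s : ℝ) :
    resolventSandwich A B s = posResolvent A s * B * posResolvent A s := rfl

theorem SpectralResolution.posResolvent_mul_mul {A C : Matrix (Fin n) (Fin n) ℂ}
    (P : SpectralResolution A) (Q : SpectralResolution C) (hA : A.PosDef) (hC : C.PosDef)
    (B : Matrix (Fin n) (Fin n) ℂ) {s : ℝ} (hs : 0 ≤ s) :
    posResolvent A s * B * posResolvent C s =
      ∑ i, ∑ j, ((s + P.val i)⁻¹ * (s + Q.val j)⁻¹) • (P.proj i * B * Q.proj j) := by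
  rw [posResolvent, posResolvent, P.resolvent_eq hA hs, Q.resolvent_eq hC hs]
  rw [Finset.sum_comm]
  simp only [Finset.sum_mul, Finset.mul_sum, smul_mul_assoc, mul_smul_comm, Finset.smul_sum,
    smul_smul, mul_comm]

theorem integrableOn_posResolvent_mul_mul {A C : Matrix (Fin n) (Fin n) ℂ} (hA : A.PosDef)
    (hC : C.PosDef) (B : Matrix (Fin n) (Fin n) ℂ) :
    IntegrableOn (fun s => posResolvent A s * B * posResolvent C s) (Ioi 0) := by
  obtain ⟨P⟩ := hA.1.nonempty_spectralResolution
  obtain ⟨Q⟩ := hC.1.nonempty_spectralResolution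
  refine IntegrableOn.congr_fun ?_
    (fun s (hs : 0 < s) => (P.posResolvent_mul_mul Q hA hC B hs.le).symm) measurableSet_Ioi
  exact integrable_finsetSum _ fun i _ => integrable_finsetSum _ fun j _ =>
    (integrableOn_inv_add_mul_inv_add (P.val_pos hA i) (Q.val_pos hC j)).smul_const _

/-- Since Pᵢ(C-A)Qⱼ = (qⱼ - pᵢ)PᵢQⱼ, each block integrates to (log qⱼ - log pᵢ)PᵢQⱼ. -/
theorem log_sub_log_eq_integral {A C : Matrix (Fin n) (Fin n) ℂ} (hA : A.PosDef) (hC : C.PosDef) :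
    CFC.log C - CFC.log A =
      ∫ s in Ioi (0 : ℝ), posResolvent A s * (C - A) * posResolvent C s := by
  obtain ⟨P⟩ := hA.1.nonempty_spectralResolution
  obtain ⟨Q⟩ := hC.1.nonempty_spectralResolution
  have hint : ∀ i j, IntegrableOn (fun s : ℝ => ((s + P.val i)⁻¹ * (s + Q.val j)⁻¹) •
      (P.proj i * (C - A) * Q.proj j)) (Ioi 0) := fun i j =>
    (integrableOn_inv_add_mul_inv_add (P.val_pos hA i) (Q.val_pos hC j)).smul_const _
  have hPA : ∀ i, P.proj i * A = P.val i • P.proj i := fun i => by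
    refine (congrArg (P.proj i * ·) P.sum_val.symm).trans ?_
    simp [Finset.mul_sum, P.proj_mul_proj]
  have hCQ : ∀ j, C * Q.proj j = Q.val j • Q.proj j := fun j => by
    refine (congrArg (· * Q.proj j) Q.sum_val.symm).trans ?_
    simp only [Finset.sum_mul, smul_mul_assoc, Q.proj_mul_proj, smul_ite, smul_zero]
    rw [Finset.sum_ite_eq' Finset.univ j fun i => Q.val i • Q.proj i]
    simp
  rw [setIntegral_congr_fun measurableSet_Ioi
    (fun s (hs : 0 < s) => P.posResolvent_mul_mul Q hA hC (C - A) hs.le),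
    integral_finsetSum _ fun i _ => integrable_finsetSum _ fun j _ => hint i j,
    Q.log_eq, P.log_eq, P.sum_smul_right Q, P.sum_smul_left Q, ← Finset.sum_sub_distrib]
  refine Finset.sum_congr rfl fun i _ => ?_
  rw [integral_finsetSum _ fun j _ => hint i j, ← Finset.sum_sub_distrib]
  refine Finset.sum_congr rfl fun j _ => ?_
  rw [integral_smul_const, mul_sub, sub_mul, hPA, mul_assoc, hCQ, mul_smul_comm, smul_mul_assoc,
    ← sub_smul, ← sub_smul, smul_smul, integral_inv_add_mul_inv_add (P.val_pos hA i)
    (Q.val_pos hC j)]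

theorem Matrix.PosDef.isUnit_det_add {A : Matrix (Fin n) (Fin n) ℂ} (hA : A.PosDef) {s : ℝ}
    (hs : 0 ≤ s) : IsUnit ((s : ℂ) • (1 : Matrix (Fin n) (Fin n) ℂ) + A).det := by
  have h : ((s : ℂ) • (1 : Matrix (Fin n) (Fin n) ℂ) + A).PosDef :=
    hA.posSemidef_add (PosSemidef.one.smul (by exact_mod_cast hs))
  exact (Matrix.isUnit_iff_isUnit_det _).mp h.isUnit

theorem posResolvent_sub {A C : Matrix (Fin n) (Fin n) ℂ} (hA : A.PosDef) (hC : C.PosDef)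
    {s : ℝ} (hs : 0 ≤ s) :
    posResolvent C s - posResolvent A s = -(posResolvent C s * (C - A) * posResolvent A s) := by
  have hA' := hA.isUnit_det_add hs
  have hC' := hC.isUnit_det_add hs
  have : C - A = ((s : ℂ) • (1 : Matrix (Fin n) (Fin n) ℂ) + C) -
    ((s : ℂ) • (1 : Matrix (Fin n) (Fin n) ℂ) + A) := by abel
  rw [this, posResolvent, posResolvent, mul_sub, sub_mul, Matrix.nonsing_inv_mul _ hC', one_mul,
    mul_assoc, Matrix.mul_nonsing_inv _ hA', mul_one, neg_sub]

/-- Square integrability of g dominates the second-order remainder; the uniform bound K controls the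
perturbed resolvent. -/
theorem Matrix.PosDef.exists_norm_posResolvent_le {A : Matrix (Fin n) (Fin n) ℂ} (hA : A.PosDef) :
    ∃ (g : ℝ → ℝ) (K : ℝ), IntegrableOn (fun s => g s ^ 2) (Ioi 0) ∧
      ∀ s > 0, ‖posResolvent A s‖ ≤ g s ∧ g s ≤ K := by
  obtain ⟨P⟩ := hA.1.nonempty_spectralResolution
  refine ⟨fun s => ∑ i, (s + P.val i)⁻¹ * ‖P.proj i‖, ∑ i, (P.val i)⁻¹ * ‖P.proj i‖, ?_,
    fun s hs => ⟨?_, ?_⟩⟩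
  · simp only [sq, Finset.sum_mul, Finset.mul_sum]
    refine integrable_finsetSum _ fun i _ => integrable_finsetSum _ fun j _ => ?_
    simp only [mul_mul_mul_comm _ ‖P.proj _‖]
    exact (integrableOn_inv_add_mul_inv_add (P.val_pos hA _) (P.val_pos hA _)).mul_const _
  · rw [posResolvent, P.resolvent_eq hA hs.le]
    refine (norm_sum_le _ _).trans (Finset.sum_le_sum fun i _ => ?_)
    have := P.val_pos hA i
    rw [norm_smul, Real.norm_of_nonneg (by positivity)]
  · refine Finset.sum_le_sum fun i _ => ?_
    have := P.val_pos hA i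
    gcongr
    linarith

open Filter Topology in
theorem Matrix.PosDef.eventually_add_smul {A B : Matrix (Fin n) (Fin n) ℂ} (hA : A.PosDef)
    (hB : B.IsHermitian) : ∀ᶠ t : ℝ in 𝓝 0, (A + t • B).PosDef := by
  open scoped MatrixOrder in
  -- The case n = 0 is separate: the spectral bound below needs a nontrivial algebra.
  rcases subsingleton_or_nontrivial (Matrix (Fin n) (Fin n) ℂ) with _ | _
  · exact Eventually.of_forall fun t => isStrictlyPositive_iff_posDef.mp .of_subsingleton
  obtain ⟨r, hr, hrA⟩ := (CFC.exists_pos_algebraMap_le_iff (A := Matrix (Fin n) (Fin n) ℂ)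
    hA.1).mpr fun x hx => hA.isStrictlyPositive.spectrum_pos hx
  have hlim : Tendsto (fun t : ℝ => ‖t • B‖) (𝓝 0) (𝓝 0) := by
    have : Continuous fun t : ℝ => ‖t • B‖ := by fun_prop
    simpa using this.tendsto 0
  filter_upwards [hlim.eventually (gt_mem_nhds hr)] with t ht
  have hsa : IsSelfAdjoint (t • B) := (IsSelfAdjoint.all t).smul hB
  have h1 := add_le_add hrA (hsa.neg_algebraMap_norm_le_self)
  rw [← map_neg, ← map_add] at h1
  exact isStrictlyPositive_iff_posDef.mp
    ((isStrictlyPositive_algebraMap (by linarith)).of_le h1)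

theorem norm_log_sub_log_sub_le {A B : Matrix (Fin n) (Fin n) ℂ} (hA : A.PosDef) :
    ∃ K δ : ℝ, 0 < δ ∧ ∀ t : ℝ, |t| < δ → (A + t • B).PosDef →
      ‖CFC.log (A + t • B) - CFC.log A - t • liebT A B‖ ≤ K * t ^ 2 := by
  obtain ⟨g, M, hg, hgM⟩ := hA.exists_norm_posResolvent_le
  have hM : 0 ≤ M := (norm_nonneg _).trans ((hgM 1 one_pos).1.trans (hgM 1 one_pos).2)
  -- This δ forces |t|M‖B‖ ≤ 1/2, so the resolvent identity gives ‖S‖ ≤ ‖S‖/2 + M, that is ‖S‖ ≤ 2M.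
  refine ⟨2 * M * ‖B‖ ^ 2 * ∫ s in Ioi (0 : ℝ), g s ^ 2, (2 * (M * ‖B‖ + 1))⁻¹, by positivity,
    fun t ht hC => ?_⟩
  have htB : |t| * (M * ‖B‖) ≤ 1 / 2 := by
    have h := mul_le_mul_of_nonneg_right ht.le (show 0 ≤ M * ‖B‖ + 1 by positivity)
    have : (2 * (M * ‖B‖ + 1))⁻¹ * (M * ‖B‖ + 1) = 1 / 2 := by field_simp
    nlinarith [abs_nonneg t]
  rw [log_sub_log_eq_integral hA hC, liebT, ← integral_smul]
  have e : ∀ s > 0, posResolvent A s * (A + t • B - A) * posResolvent (A + t • B) s -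
      t • resolventSandwich A B s = (-t ^ 2) • (posResolvent A s * B *
        (posResolvent (A + t • B) s * B * posResolvent A s)) := by
    intro s hs
    have h := posResolvent_sub hA hC (le_of_lt hs)
    rw [add_sub_cancel_left] at h ⊢
    rw [resolventSandwich_eq, mul_smul_comm, smul_mul_assoc, ← smul_sub, ← mul_sub, h]
    simp only [mul_smul_comm, smul_mul_assoc, mul_neg, smul_neg, smul_smul, neg_smul, sq]
  have i1 := integrableOn_posResolvent_mul_mul hA hC (A + t • B - A)
  have i2 : IntegrableOn (fun s => t • resolventSandwich A B s) (Ioi 0) :=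
    (integrableOn_posResolvent_mul_mul hA hA B).smul t
  rw [← integral_sub i1 i2, mul_right_comm, ← integral_const_mul]
  refine norm_integral_le_of_norm_le (hg.const_mul _) ?_
  refine (ae_restrict_mem measurableSet_Ioi).mono fun s hs => ?_
  have hs : 0 < s := hs
  rw [e s hs]
  set R := posResolvent A s
  set S := posResolvent (A + t • B) s
  obtain ⟨hR, hRM⟩ := hgM s hs
  have hRn : ‖R‖ ≤ M := hR.trans hRM
  have hS : ‖S‖ ≤ 2 * M := by
    have h := posResolvent_sub hA hC hs.le
    rw [add_sub_cancel_left, mul_smul_comm, smul_mul_assoc, sub_eq_iff_eq_add] at h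
    have h1 : ‖S‖ ≤ |t| * (‖S‖ * ‖B‖ * ‖R‖) + ‖R‖ := by
      calc ‖S‖ = ‖-(t • (S * B * R)) + R‖ := by rw [← h]
        _ ≤ ‖t • (S * B * R)‖ + ‖R‖ := by
          rw [← norm_neg (t • (S * B * R))]; exact norm_add_le _ _
        _ ≤ _ := by
          rw [norm_smul, Real.norm_eq_abs]
          gcongr
          exact norm_mul₃_le
    have h2 : |t| * (‖S‖ * ‖B‖ * ‖R‖) ≤ ‖S‖ * (1 / 2) := by
      calc |t| * (‖S‖ * ‖B‖ * ‖R‖) ≤ |t| * (‖S‖ * ‖B‖ * M) := by gcongr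
        _ = ‖S‖ * (|t| * (M * ‖B‖)) := by ring
        _ ≤ _ := by gcongr
    linarith
  have h3 : ‖R * B * (S * B * R)‖ ≤ g s * ‖B‖ * (2 * M * ‖B‖ * g s) := by
    calc _ ≤ ‖R * B‖ * ‖S * B * R‖ := norm_mul_le _ _
      _ ≤ (‖R‖ * ‖B‖) * (‖S‖ * ‖B‖ * ‖R‖) := by
        gcongr
        · exact norm_mul_le _ _
        · exact norm_mul₃_le
      _ ≤ _ := by gcongr; exact mul_nonneg ((norm_nonneg _).trans hR) (norm_nonneg _)
  rw [norm_smul, norm_neg, Real.norm_of_nonneg (sq_nonneg t)]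
  calc _ ≤ t ^ 2 * (g s * ‖B‖ * (2 * M * ‖B‖ * g s)) := by gcongr
    _ = _ := by ring

open Filter Topology in
theorem hasDerivAt_log_add_smul {A B : Matrix (Fin n) (Fin n) ℂ} (hA : A.PosDef)
    (hB : B.IsHermitian) :
    HasDerivAt (fun t : ℝ => CFC.log (A + t • B)) (liebT A B) 0 := by
  rw [hasDerivAt_iff_isLittleO_nhds_zero]
  obtain ⟨K, δ, hδ, hK⟩ := norm_log_sub_log_sub_le (B := B) hA
  refine Asymptotics.IsBigO.trans_isLittleO (g := fun t : ℝ => t ^ 2) ?_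
    (Asymptotics.isLittleO_pow_id one_lt_two)
  refine Asymptotics.IsBigO.of_bound K ?_
  filter_upwards [hA.eventually_add_smul hB, Metric.ball_mem_nhds 0 hδ] with t ht htδ
  have := hK t (by simpa using htδ) ht
  simpa using this

/-- A derivative of a self-adjoint curve is self-adjoint. -/
theorem isHermitian_liebT {A B : Matrix (Fin n) (Fin n) ℂ} (hA : A.PosDef) (hB : B.IsHermitian) :
    (liebT A B).IsHermitian := by
  have h := hasDerivAt_log_add_smul hA hB
  refine HasDerivAt.unique (h.star.congr_of_eventuallyEq (Filter.Eventually.of_forall fun t => ?_)) h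
  exact (IsSelfAdjoint.log (a := A + t • B)).star_eq.symm

end Resolvent

/-! ### Gibbs principle, Lieb concavity and the triple inequality -/

section TraceExp

variable {n : ℕ}

theorem Matrix.IsHermitian.im_trace {M : Matrix (Fin n) (Fin n) ℂ} (hM : M.IsHermitian) :
    (trace M).im = 0 := by
  rw [← Complex.conj_eq_iff_im, ← Complex.star_def, ← trace_conjTranspose, hM.eq]

theorem Matrix.IsHermitian.im_trace_mul {M N : Matrix (Fin n) (Fin n) ℂ} (hM : M.IsHermitian)
    (hN : N.IsHermitian) : (trace (M * N)).im = 0 := by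
  rw [← Complex.conj_eq_iff_im, ← Complex.star_def, ← trace_conjTranspose, conjTranspose_mul,
    hM.eq, hN.eq, trace_mul_comm]

/-- The Gibbs variational principle. -/
theorem gibbs_le_trace_exp {S T : Matrix (Fin n) (Fin n) ℂ} (hS : S.IsHermitian)
    (hT : T.PosDef) :
    (trace (T * (S - CFC.log T))).re + (trace T).re ≤ (trace (NormedSpace.exp S)).re := by
  have h := matrixRelEntropy_nonneg hS.posDef_exp hT
  rw [matrixRelEntropy, CFC.log_exp S hS] at h
  rw [← neg_sub, mul_neg, trace_neg, Complex.neg_re]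
  linarith

theorem trace_mul_sub_matrixRelEntropy_le {H X T : Matrix (Fin n) (Fin n) ℂ} (hH : H.IsHermitian)
    (hT : T.PosDef) :
    (trace (T * H)).re - matrixRelEntropy X T + (trace X).re ≤
      (trace (NormedSpace.exp (H + CFC.log X))).re := by
  have h := gibbs_le_trace_exp (hH.add (IsHermitian.cfcLog X)) hT
  simp only [matrixRelEntropy, mul_sub, mul_add, trace_sub, trace_add, Complex.sub_re,
    Complex.add_re] at h ⊢
  linarith

/-- The Gibbs bound is attained at T = exp(H + log X). -/
theorem trace_exp_add_log_eq {H X : Matrix (Fin n) (Fin n) ℂ} (hH : H.IsHermitian) :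
    (trace (NormedSpace.exp (H + CFC.log X))).re =
      (trace (NormedSpace.exp (H + CFC.log X) * H)).re -
        matrixRelEntropy X (NormedSpace.exp (H + CFC.log X)) + (trace X).re := by
  rw [matrixRelEntropy, CFC.log_exp _ (hH.add (IsHermitian.cfcLog X)), add_sub_cancel_right]
  ring

theorem convex_setOf_posDef : Convex ℝ {X : Matrix (Fin n) (Fin n) ℂ | X.PosDef} :=
  fun _ hX _ hY _ _ ha hb hab => hX.combo hY ha hb hab

/-- Lieb's concavity theorem for the trace exponential. -/
theorem concaveOn_trace_exp_add_log {H : Matrix (Fin n) (Fin n) ℂ} (hH : H.IsHermitian) :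
    ConcaveOn ℝ {X : Matrix (Fin n) (Fin n) ℂ | X.PosDef}
      (fun X => (trace (NormedSpace.exp (H + CFC.log X))).re) := by
  refine ⟨convex_setOf_posDef, fun X hX Y hY a b ha hb hab => ?_⟩
  have hX' := (hH.add (IsHermitian.cfcLog X)).posDef_exp
  have hY' := (hH.add (IsHermitian.cfcLog Y)).posDef_exp
  -- The trial T at aX + bY is the same combination of the optimizers for X and Y.
  have h := trace_mul_sub_matrixRelEntropy_le (X := a • X + b • Y) hH
    (hX'.combo hY' ha hb hab)
  have hD := matrixRelEntropy_combo_le hX hY hX' hY' ha hb hab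
  simp only [smul_eq_mul]
  rw [trace_exp_add_log_eq (X := X) hH, trace_exp_add_log_eq (X := Y) hH]
  refine le_trans ?_ h
  simp only [add_mul, smul_mul_assoc, trace_add, trace_smul, Complex.add_re, Complex.real_smul,
    Complex.re_ofReal_mul]
  linarith

theorem log_smul_of_posDef {X : Matrix (Fin n) (Fin n) ℂ} (hX : X.PosDef) {r : ℝ} (hr : 0 < r) :
    CFC.log (r • X) = Real.log r • (1 : Matrix (Fin n) (Fin n) ℂ) + CFC.log X := by
  open scoped MatrixOrder in
  rw [CFC.log_smul' X hr hX.isStrictlyPositive, Algebra.algebraMap_eq_smul_one]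

theorem trace_exp_add_log_smul {H X : Matrix (Fin n) (Fin n) ℂ} (hX : X.PosDef)
    {r : ℝ} (hr : 0 < r) :
    (trace (NormedSpace.exp (H + CFC.log (r • X)))).re =
      r * (trace (NormedSpace.exp (H + CFC.log X))).re := by
  have hc : Commute (Real.log r • (1 : Matrix (Fin n) (Fin n) ℂ)) (H + CFC.log X) :=
    (Commute.one_left _).smul_left _
  have he : NormedSpace.exp (Real.log r • (1 : Matrix (Fin n) (Fin n) ℂ)) =
      r • (1 : Matrix (Fin n) (Fin n) ℂ) := by
    rw [← Algebra.algebraMap_eq_smul_one, ← NormedSpace.algebraMap_exp_comm, ← Real.exp_eq_exp_ℝ,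
      Real.exp_log hr, Algebra.algebraMap_eq_smul_one]
  rw [log_smul_of_posDef hX hr, add_left_comm, Matrix.exp_add_of_commute _ _ hc, he]
  simp

/-- Concavity with weights 1/(1+t) and t/(1+t), then degree-one homogeneity to clear the factor
1/(1+t). -/
theorem trace_exp_add_log_superadditive {H X Y : Matrix (Fin n) (Fin n) ℂ} (hH : H.IsHermitian)
    (hX : X.PosDef) (hY : Y.PosDef) {t : ℝ} (ht : 0 < t) :
    (trace (NormedSpace.exp (H + CFC.log X))).re + t * (trace (NormedSpace.exp (H + CFC.log Y))).re
      ≤ (trace (NormedSpace.exp (H + CFC.log (X + t • Y)))).re := by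
  have h1 : 0 < (1 + t)⁻¹ := by positivity
  have h := (concaveOn_trace_exp_add_log hH).2 hX hY h1.le
    (show 0 ≤ (1 + t)⁻¹ * t by positivity) (by field_simp)
  have e : (1 + t)⁻¹ • X + ((1 + t)⁻¹ * t) • Y = (1 + t)⁻¹ • (X + t • Y) := by
    rw [smul_add, smul_smul]
  simp only [e] at h
  rw [trace_exp_add_log_smul (hX.add (hY.smul ht)) h1] at h
  simp only [smul_eq_mul, mul_assoc] at h
  rw [← mul_add] at h
  exact le_of_mul_le_mul_left h h1

/-- The gradient inequality for the convex function tr exp, from Gibbs at T = exp S'. -/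
theorem trace_exp_sub_le {S S' : Matrix (Fin n) (Fin n) ℂ} (hS : S.IsHermitian)
    (hS' : S'.IsHermitian) :
    (trace (NormedSpace.exp S')).re - (trace (NormedSpace.exp S)).re ≤
      (trace (NormedSpace.exp S' * (S' - S))).re := by
  have h := gibbs_le_trace_exp hS hS'.posDef_exp
  rw [CFC.log_exp S' hS', ← neg_sub, mul_neg, trace_neg, Complex.neg_re] at h
  linarith

open Filter Topology in
/-- Lieb's triple matrix inequality. -/
theorem trace_exp_add_log_le_trace_mul_liebT {H X Y : Matrix (Fin n) (Fin n) ℂ}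
    (hH : H.IsHermitian) (hX : X.PosDef) (hY : Y.PosDef) :
    (trace (NormedSpace.exp (H + CFC.log Y))).re ≤
      (trace (NormedSpace.exp (H + CFC.log X) * liebT X Y)).re := by
  have hd := hasDerivAt_log_add_smul hX hY.1
  -- Only the right-hand limit is used, as superadditivity needs t > 0.
  have hslope := (hasDerivAt_iff_tendsto_slope_zero.mp hd).mono_left
    (nhdsWithin_mono 0 (fun t (ht : 0 < t) => ht.ne') : 𝓝[>] (0 : ℝ) ≤ 𝓝[≠] 0)
  have hcont : Tendsto (fun t : ℝ => NormedSpace.exp (H + CFC.log (X + t • Y))) (𝓝[>] 0)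
      (𝓝 (NormedSpace.exp (H + CFC.log X))) := by
    let +nondep : NormedAlgebra ℚ (Matrix (Fin n) (Fin n) ℂ) := .restrictScalars ℚ ℂ _
    have h := ((NormedSpace.exp_continuous (𝔸 := Matrix (Fin n) (Fin n) ℂ)).continuousAt.comp
      (hd.continuousAt.const_add H)).tendsto
    simp only [Function.comp_def, zero_smul, add_zero] at h
    exact h.mono_left nhdsWithin_le_nhds
  have htr : Continuous fun M : Matrix (Fin n) (Fin n) ℂ => (trace M).re :=
    Complex.continuous_re.comp continuous_id.matrix_trace
  refine ge_of_tendsto ((htr.tendsto _).comp (hcont.mul hslope)) ?_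
  filter_upwards [self_mem_nhdsWithin] with t ht
  have ht : 0 < t := ht
  have h1 := trace_exp_add_log_superadditive hH hX hY ht
  have h2 := trace_exp_sub_le (hH.add (IsHermitian.cfcLog X))
    (hH.add (IsHermitian.cfcLog (X + t • Y)))
  rw [add_sub_add_left_eq_sub] at h2
  simp only [Function.comp_apply, zero_add, zero_smul, add_zero, mul_smul_comm, trace_smul,
    Complex.real_smul, Complex.re_ofReal_mul]
  rw [le_inv_mul_iff₀ ht]
  linarith

end TraceExp

theorem theorem7p6 (n : ℕ) :
    -- the function X ↦ tr exp(H + log X) is real-valued and concave on positive definite matrices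
    (∀ H : Matrix (Fin n) (Fin n) ℂ, H.IsHermitian →
      (∀ X : Matrix (Fin n) (Fin n) ℂ, X.PosDef →
        (trace (NormedSpace.exp (H + CFC.log X))).im = 0) ∧
      ConcaveOn ℝ {X : Matrix (Fin n) (Fin n) ℂ | X.PosDef}
        (fun X => (trace (NormedSpace.exp (H + CFC.log X))).re)) ∧
    -- the integral defining T_A(B) converges absolutely
    (∀ A B : Matrix (Fin n) (Fin n) ℂ, A.PosDef →
      IntegrableOn (resolventSandwich A B) (Ioi (0 : ℝ))) ∧
    -- T_A(B) is the derivative of t ↦ log(A + tB) at t = 0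
    (∀ A B : Matrix (Fin n) (Fin n) ℂ, A.PosDef → B.IsHermitian →
      HasDerivAt (fun t : ℝ => CFC.log (A + t • B)) (liebT A B) 0) ∧
    -- the triple matrix inequality, between two real numbers
    (∀ H K L : Matrix (Fin n) (Fin n) ℂ, H.IsHermitian → K.IsHermitian → L.IsHermitian →
      (trace (NormedSpace.exp (H + K + L))).im = 0 ∧
      (trace (NormedSpace.exp H * liebT (NormedSpace.exp (-K)) (NormedSpace.exp L))).im = 0 ∧
      (trace (NormedSpace.exp (H + K + L))).re ≤
        (trace (NormedSpace.exp H * liebT (NormedSpace.exp (-K)) (NormedSpace.exp L))).re) := by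
  refine ⟨fun H hH => ⟨fun X _ => ?_, concaveOn_trace_exp_add_log hH⟩,
    fun A B hA => integrableOn_posResolvent_mul_mul hA hA B,
    fun A B hA hB => hasDerivAt_log_add_smul hA hB, fun H K L hH hK hL => ⟨?_, ?_, ?_⟩⟩
  · exact (hH.add (IsHermitian.cfcLog X)).posDef_exp.1.im_trace
  · exact ((hH.add hK).add hL).posDef_exp.1.im_trace
  · exact hH.posDef_exp.1.im_trace_mul (isHermitian_liebT hK.neg.posDef_exp hL.posDef_exp.1)
  -- With H + K in place of H and X = exp(-K), log X cancels K in the right-hand exponential.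
  · have h := trace_exp_add_log_le_trace_mul_liebT (hH.add hK) hK.neg.posDef_exp hL.posDef_exp
    rwa [CFC.log_exp L hL, CFC.log_exp (-K) hK.neg, add_neg_cancel_right] at h
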